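/- Let $n \ge 1$ be an integer and let $A$ be a multiset of $2n-2$ elements (counted with multiplicity) of $\mathbb{Z}_n = \mathbb{Z}/n\mathbb{Z}$. Suppose that $A$ has no sub-multiset of size $n$ whose elements sum to $0$ in $\mathbb{Z}_n$. Then there exist $a, b \in \mathbb{Z}_n$ with $\gcd(b-a, n) = 1$ such that $A$ consists of exactly $n-1$ copies of $a$ and $n-1$ copies of $b$. -/

import Mathlib

/-! The property `InverseEGZ` is proved for primes and shown to pass to products; coprimality of `b
- a` with `n` comes last, since a common factor would produce a zero sum.

For a prime `p ≥ 5`, no element occurs `p` times, so `A` splits into `p - 1` pairs of distinct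
elements. Taking both entries of one pair and one entry of each other pair gives `p` terms. By
Cauchy–Davenport these sums reach every residue unless all pairs have the same difference up to sign
(`ZeroSumFree.diff_eq_or_eq`). Re-pairing then forces all pairs to coincide.

For modulus `p * m`, lift to integers and cut off `2 * m - 2` blocks of `p` terms with sum divisible
by `p`. The remainder is extremal mod `p`, whichever blocks are chosen, so only two residues mod `p`
occur (`eq_or_eq_of_remainders`). The block sums divided by `p` are extremal mod `m`; exchanging one
term of a block for a congruent one shows that the two are equal mod `p * m`
(`ZeroSumFree.intCast_eq_of_swap`). -/

open Multiset in
theorem Multiset.exists_le_map_eq {α β : Type*} (f : α → β) (A : Multiset α) :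
    ∀ B : Multiset β, B ≤ A.map f → ∃ C ≤ A, C.map f = B := by
  classical
  induction A using Multiset.induction with
  | empty =>
    intro B hB
    exact ⟨0, le_rfl, by rw [map_zero] at hB ⊢; exact (le_zero.1 hB).symm⟩
  | cons a A ih =>
    intro B hB
    rw [map_cons] at hB
    by_cases h : f a ∈ B
    · obtain ⟨B', rfl⟩ := exists_cons_of_mem h
      obtain ⟨C, hC, rfl⟩ := ih B' ((cons_le_cons_iff _).1 hB)
      exact ⟨a ::ₘ C, (cons_le_cons_iff _).2 hC, map_cons _ _ _⟩
    · obtain ⟨C, hC, rfl⟩ := ih B ((le_cons_of_notMem h).1 hB)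
      exact ⟨C, hC.trans (le_cons_self _ _), rfl⟩

open Multiset in
/-- A multiset of even size in which no element fills more than half of the places splits into
pairs of distinct elements. -/
theorem Multiset.exists_pairing {α : Type*} [DecidableEq α] (k : ℕ) :
    ∀ A : Multiset α, card A = 2 * k → (∀ x, A.count x ≤ k) →
      ∃ P : Multiset (α × α), card P = k ∧ (∀ q ∈ P, q.1 ≠ q.2) ∧
        P.map Prod.fst + P.map Prod.snd = A := by
  induction k with
  | zero =>
    intro A hA _
    exact ⟨0, rfl, by simp, by simpa [eq_comm] using hA⟩
  | succ k ih =>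
    intro A hA hcount
    have hne : A.toFinset.Nonempty := by
      rw [toFinset_nonempty, ← card_pos]; omega
    obtain ⟨x, hx, hxmax⟩ := Finset.exists_max_image A.toFinset (fun z => A.count z) hne
    have hne' : (A.toFinset.erase x).Nonempty := by
      rw [Finset.nonempty_iff_ne_empty]
      intro h
      have h1 : ∀ b ∈ A, b = x := by
        intro b hb
        by_contra hbx
        have : b ∈ A.toFinset.erase x := by simp [hbx, hb]
        simp [h] at this
      have h2 := eq_replicate_of_mem h1
      have h3 := hcount x
      rw [h2, count_replicate_self] at h3
      omega
    -- Pair off the two most frequent elements. A third element occurring more than `k` times would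
    -- force three multiplicities of at least `k + 1` in a multiset of size `2 * (k + 1)`.
    obtain ⟨y, hy, hymax⟩ := Finset.exists_max_image _ (fun z => A.count z) hne'
    obtain ⟨hyx, hy⟩ := Finset.mem_erase.1 hy
    obtain ⟨A1, rfl⟩ := exists_cons_of_mem (mem_toFinset.1 hx)
    have hyA1 : y ∈ A1 := by
      simpa [hyx] using hy
    obtain ⟨A', rfl⟩ := exists_cons_of_mem hyA1
    obtain ⟨P, hP, hPne, hPA⟩ := ih A' (by simp at hA; omega) (by
      intro z
      by_contra! hz
      have hz0 := hcount z
      have hzx : z ≠ x := by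
        rintro rfl
        simp [count_cons] at hz0; omega
      have hzy : z ≠ y := by
        rintro rfl
        simp [count_cons] at hz0; omega
      have hzA : z ∈ A' := count_pos.1 (by omega)
      have h1 := hxmax z (by simp [hzA])
      have h2 := hymax z (by simp [hzA, hzx])
      have h3 := Finset.sum_le_sum_of_subset
        (f := fun z => count z (x ::ₘ y ::ₘ A')) (s := {x, y, z})
        (t := (x ::ₘ y ::ₘ A').toFinset) (by
          intro w hw
          simp only [Finset.mem_insert, Finset.mem_singleton] at hw
          rcases hw with rfl | rfl | rfl <;> simp [hzA])
      rw [toFinset_sum_count_eq, hA, Finset.sum_insert (by simp [hyx.symm, hzx.symm]),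
        Finset.sum_pair hzy.symm] at h3
      have h4 : count z (x ::ₘ y ::ₘ A') = count z A' := by
        simp [hzx, hzy]
      omega)
    refine ⟨(x, y) ::ₘ P, by simp [hP], ?_, ?_⟩
    · intro q hq
      rcases mem_cons.1 hq with rfl | hq
      · exact hyx.symm
      · exact hPne q hq
    · rw [← hPA, map_cons, map_cons, cons_add, add_cons]

/-! ### Multisets without zero sums of length `n` -/

/-- No `n` terms of `A`, counted with multiplicity, sum to zero. -/
def ZeroSumFree (n : ℕ) (A : Multiset (ZMod n)) : Prop :=
  ∀ B ≤ A, Multiset.card B = n → B.sum ≠ 0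

theorem ZeroSumFree.mono {n : ℕ} {A A' : Multiset (ZMod n)} (h : ZeroSumFree n A) (hA : A' ≤ A) :
    ZeroSumFree n A' :=
  fun B hB => h B (hB.trans hA)

theorem ZeroSumFree.count_lt {n : ℕ} {A : Multiset (ZMod n)} (h : ZeroSumFree n A)
    (x : ZMod n) : A.count x < n := by
  by_contra! hx
  exact h (Multiset.replicate n x) (Multiset.le_count_iff_replicate_le.1 hx) (by simp) (by simp)

theorem ZeroSumFree.gcd_eq_one {n : ℕ} (hn : 1 ≤ n) {a b : ZMod n}
    (h : ZeroSumFree n (Multiset.replicate (n - 1) a + Multiset.replicate (n - 1) b)) :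
    Nat.gcd (b - a).val n = 1 := by
  have : NeZero n := ⟨by omega⟩
  by_contra hg
  set g := Nat.gcd (b - a).val n with hgdef
  have hg0 : 0 < g := Nat.gcd_pos_of_pos_right _ hn
  obtain ⟨k, hk⟩ : g ∣ n := Nat.gcd_dvd_right _ _
  obtain ⟨l, hl⟩ : g ∣ (b - a).val := Nat.gcd_dvd_left _ _
  have hk0 : 0 < k := by
    rcases Nat.eq_zero_or_pos k with h0 | h0
    · simp [h0] at hk; omega
    · exact h0
  have hkn : k < n := by
    have : 2 * k ≤ g * k := Nat.mul_le_mul_right _ (by omega)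
    omega
  -- With `k = n / g`, this sum is `n * a + k * (b - a)`, and `n` divides `k * (b - a)`.
  refine h (Multiset.replicate (n - k) a + Multiset.replicate k b)
    (add_le_add ((Multiset.replicate_le_replicate _).2 (by omega))
      ((Multiset.replicate_le_replicate _).2 (by omega))) ?_ ?_
  · simp; omega
  · have h1 : (k : ZMod n) * (b - a) = 0 := by
      rw [← ZMod.natCast_zmod_val (b - a), hl, ← Nat.cast_mul, ZMod.natCast_eq_zero_iff]
      exact ⟨l, by rw [← mul_assoc, mul_comm k, ← hk]⟩
    rw [Multiset.sum_add, Multiset.sum_replicate, Multiset.sum_replicate, nsmul_eq_mul,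
      nsmul_eq_mul, Nat.cast_sub hkn.le, ZMod.natCast_self]
    linear_combination h1

theorem ZeroSumFree.ne {n : ℕ} (hn : 2 ≤ n) {a b : ZMod n}
    (h : ZeroSumFree n (Multiset.replicate (n - 1) a + Multiset.replicate (n - 1) b)) :
    a ≠ b := by
  rintro rfl
  have := h.count_lt a
  simp at this
  omega

/-! ### Prime moduli, by Cauchy–Davenport -/

section Prime

variable {p : ℕ} [Fact p.Prime]

open Multiset Pointwise

/-- Sums obtained by choosing one entry from each pair. -/
def Selectable (P : Multiset (ZMod p × ZMod p)) (S : Finset (ZMod p)) : Prop :=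
  ∀ s ∈ S, ∃ B ≤ P.map Prod.fst + P.map Prod.snd, card B = card P ∧ B.sum = s

theorem Selectable.cons {P : Multiset (ZMod p × ZMod p)} {S : Finset (ZMod p)}
    (h : Selectable P S) (q : ZMod p × ZMod p) : Selectable (q ::ₘ P) ({q.1, q.2} + S) := by
  intro s hs
  obtain ⟨u, hu, v, hv, rfl⟩ := Finset.mem_add.1 hs
  obtain ⟨B, hB, hBc, rfl⟩ := h v hv
  refine ⟨u ::ₘ B, ?_, by simp [hBc], by simp⟩
  rw [map_cons, map_cons, cons_add, add_cons]
  simp only [Finset.mem_insert, Finset.mem_singleton] at hu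
  rcases hu with rfl | rfl
  · exact cons_le_cons _ (hB.trans (le_cons_self _ _))
  · rw [cons_swap]
    exact cons_le_cons _ (hB.trans (le_cons_self _ _))

theorem Selectable.exists_add {P : Multiset (ZMod p × ZMod p)} {S : Finset (ZMod p)}
    (h : Selectable P S) (hS : S.Nonempty) (Q : Multiset (ZMod p × ZMod p))
    (hQ : ∀ q ∈ Q, q.1 ≠ q.2) :
    ∃ S', Selectable (Q + P) S' ∧ S'.Nonempty ∧ min p (S.card + card Q) ≤ S'.card := by
  induction Q using Multiset.induction with
  | empty => exact ⟨S, by simpa using h, hS, by simp⟩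
  | cons q Q ih =>
    obtain ⟨S', h1, h2, h3⟩ := ih (fun r hr => hQ r (mem_cons_of_mem hr))
    refine ⟨_, by rw [cons_add]; exact h1.cons q, (Finset.insert_nonempty _ _).add h2, ?_⟩
    have h4 := ZMod.cauchy_davenport (Fact.out : p.Prime)
      (Finset.insert_nonempty q.1 {q.2}) h2
    rw [Finset.card_pair (hQ q (mem_cons_self _ _))] at h4
    rw [card_cons]
    refine le_trans ?_ h4
    omega

theorem selectable_pair (q r : ZMod p × ZMod p) :
    Selectable {q, r} {q.1 + r.1, q.1 + r.2, q.2 + r.1, q.2 + r.2} := by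
  have h0 : Selectable (0 : Multiset (ZMod p × ZMod p)) {0} := by
    intro s hs
    exact ⟨0, by simp, rfl, by simpa using (Finset.mem_singleton.1 hs).symm⟩
  have h := (h0.cons r).cons q
  intro s hs
  refine h s ?_
  simp only [Finset.mem_insert, Finset.mem_singleton] at hs
  simp only [Finset.mem_add]
  rcases hs with rfl | rfl | rfl | rfl <;> simp

/-- Otherwise the pairs `q` and `r` alone give four sums. Set aside one pair `t`; the other `p - 4`
pairs of `P` each add at least one sum, so all of `ZMod p` is reached, including `-(t.1 + t.2)`. -/
theorem ZeroSumFree.diff_eq_or_eq {q r : ZMod p × ZMod p} {P : Multiset (ZMod p × ZMod p)}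
    (hcard : card P + 3 = p) (hP0 : P ≠ 0) (hP : ∀ t ∈ P, t.1 ≠ t.2)
    (hq : q.1 ≠ q.2) (hr : r.1 ≠ r.2)
    (h : ZeroSumFree p ((q ::ₘ r ::ₘ P).map Prod.fst + (q ::ₘ r ::ₘ P).map Prod.snd)) :
    q.2 - q.1 = r.2 - r.1 ∨ q.2 - q.1 = r.1 - r.2 := by
  by_contra! hne
  obtain ⟨t, ht⟩ := exists_mem_of_ne_zero hP0
  obtain ⟨P, rfl⟩ := exists_cons_of_mem ht
  have h4 : ({q.1 + r.1, q.1 + r.2, q.2 + r.1, q.2 + r.2} : Finset (ZMod p)).card = 4 := by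
    rw [Finset.card_insert_of_notMem, Finset.card_insert_of_notMem, Finset.card_pair]
    · simpa using hr
    · simp only [Finset.mem_insert, Finset.mem_singleton, not_or]
      exact ⟨fun e => hne.1 (by linear_combination -e), by simpa using hq⟩
    · simp only [Finset.mem_insert, Finset.mem_singleton, not_or]
      exact ⟨by simpa using hr, by simpa using hq, fun e => hne.2 (by linear_combination -e)⟩
  obtain ⟨S, hS, -, hSc⟩ := (selectable_pair q r).exists_add (Finset.insert_nonempty _ _) P
    (fun s hs => hP s (mem_cons_of_mem hs))
  rw [h4] at hSc
  rw [card_cons] at hcard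
  have huniv : S = Finset.univ := by
    rw [← Finset.card_eq_iff_eq_univ, ZMod.card]
    have := Finset.card_le_univ S
    rw [ZMod.card] at this
    omega
  obtain ⟨B, hB, hBc, hBs⟩ := hS (-(t.1 + t.2)) (by simp [huniv])
  refine h (t.1 ::ₘ t.2 ::ₘ B) ?_ ?_ ?_
  · have : (q ::ₘ r ::ₘ t ::ₘ P).map Prod.fst + (q ::ₘ r ::ₘ t ::ₘ P).map Prod.snd
        = t.1 ::ₘ t.2 ::ₘ ((P + {q, r}).map Prod.fst + (P + {q, r}).map Prod.snd) := by
      simp only [Multiset.map_add, insert_eq_cons, map_singleton, ← singleton_add]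
      abel
    rw [this]
    exact cons_le_cons _ (cons_le_cons _ hB)
  · simp at hBc
    simp [hBc]; omega
  · simp [hBs]

theorem exists_orientation {d : ZMod p} (P : Multiset (ZMod p × ZMod p))
    (hP : ∀ q ∈ P, q.2 - q.1 = d ∨ q.2 - q.1 = -d) :
    ∃ C, card C = card P ∧ P.map Prod.fst + P.map Prod.snd = C + C.map (· + d) := by
  induction P using Multiset.induction with
  | empty => exact ⟨0, rfl, rfl⟩
  | cons q P ih =>
    obtain ⟨C, hC, hPC⟩ := ih fun r hr => hP r (mem_cons_of_mem hr)
    rcases hP q (mem_cons_self _ _) with h | h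
    · refine ⟨q.1 ::ₘ C, by simp [hC], ?_⟩
      have : q.2 = q.1 + d := by linear_combination h
      rw [map_cons, map_cons, map_cons, cons_add, cons_add, add_cons, add_cons, hPC, this]
    · refine ⟨q.2 ::ₘ C, by simp [hC], ?_⟩
      have : q.1 = q.2 + d := by linear_combination -h
      rw [map_cons, map_cons, map_cons, cons_add, cons_add, add_cons, add_cons, hPC, this,
        cons_swap]

/-- Among pairs `(c, c + d)` without a zero-sum selection, any two first entries are equal or
differ by `d`. -/
theorem ZeroSumFree.sub_eq_or_eq (hp : 5 ≤ p) {c e d : ZMod p} {C : Multiset (ZMod p)}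
    (hd : d ≠ 0) (hcard : card C + 3 = p) (hce : c ≠ e)
    (h : ZeroSumFree p ((c ::ₘ e ::ₘ C) + (c ::ₘ e ::ₘ C).map (· + d))) :
    e = c + d ∨ c = e + d := by
  obtain ⟨f, hf⟩ := exists_mem_of_ne_zero (s := C) (by rintro rfl; simp at hcard; omega)
  obtain ⟨C, rfl⟩ := exists_cons_of_mem hf
  rw [card_cons] at hcard
  -- Re-pair `(c, c + d), (e, e + d)` as `(c, e), (c + d, e + d)` and compare the difference `e - c`
  -- with that of an untouched pair.
  have h' := ZeroSumFree.diff_eq_or_eq (q := (c, e)) (r := (f, f + d))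
    (P := (c + d, e + d) ::ₘ C.map fun x => (x, x + d)) (by simpa using hcard) (by simp)
    (by
      intro t ht
      rcases mem_cons.1 ht with rfl | ht
      · simpa using hce
      · obtain ⟨x, -, rfl⟩ := mem_map.1 ht
        simpa using hd) hce (by simpa using hd) (by
      convert h using 1
      simp only [map_cons, Multiset.map_map, Function.comp_def, map_id']
      simp only [← singleton_add]
      abel)
  rcases h' with h' | h'
  · left; linear_combination h'
  · right; linear_combination -h'

theorem exists_eq_replicate_of_five_le (hp : 5 ≤ p) (A : Multiset (ZMod p))
    (hA : card A = 2 * p - 2) (h : ZeroSumFree p A) :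
    ∃ a b, A = replicate (p - 1) a + replicate (p - 1) b := by
  obtain ⟨P, hP, hne, rfl⟩ := exists_pairing (p - 1) A (by omega) (fun x => by
    have := h.count_lt x; omega)
  obtain ⟨q, hq⟩ := exists_mem_of_ne_zero (s := P) (by rintro rfl; simp at hP; omega)
  obtain ⟨C, hC, hCA⟩ := exists_orientation (d := q.2 - q.1) P (by
    intro r hr
    obtain ⟨P, rfl⟩ := exists_cons_of_mem hq
    rcases mem_cons.1 hr with rfl | hr
    · exact Or.inl rfl
    · obtain ⟨P, rfl⟩ := exists_cons_of_mem hr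
      simp only [card_cons] at hP
      rw [cons_swap] at h
      rcases h.diff_eq_or_eq (by omega) (by rintro rfl; simp at hP; omega)
        (fun t ht => hne t (by simp [ht])) (hne r (by simp)) (hne q (by simp)) with e | e
      · exact Or.inl e
      · right; rw [e]; ring)
  have hd : q.2 - q.1 ≠ 0 := sub_ne_zero.2 (hne q hq).symm
  generalize q.2 - q.1 = d at hCA hd
  rw [hCA] at h ⊢
  rw [hP] at hC
  clear hA hCA hne hq q hP P
  obtain ⟨c, hc⟩ := exists_mem_of_ne_zero (s := C) (by rintro rfl; simp at hC; omega)
  by_cases hconst : ∀ e ∈ C, e = c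
  · rw [eq_replicate_of_mem hconst, hC]
    exact ⟨c, c + d, by simp⟩
  exfalso
  have key : ∀ c e, c ∈ C → e ∈ C → c ≠ e → e = c + d ∨ c = e + d := by
    intro c e hc he hce
    obtain ⟨C, rfl⟩ := exists_cons_of_mem hc
    obtain ⟨C, rfl⟩ := exists_cons_of_mem ((mem_cons.1 he).resolve_left hce.symm)
    simp only [card_cons] at hC
    exact h.sub_eq_or_eq hp hd (by omega) hce
  have hstep : ∃ c ∈ C, c + d ∈ C := by
    push Not at hconst
    obtain ⟨e, he, hec⟩ := hconst
    rcases key c e hc he hec.symm with rfl | rfl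
    · exact ⟨c, hc, he⟩
    · exact ⟨e, he, hc⟩
  clear hconst hc c
  obtain ⟨c, hc, hcd⟩ := hstep
  have h3 : (3 : ZMod p) ≠ 0 := fun h3 => absurd
    (Nat.le_of_dvd (by norm_num) ((ZMod.natCast_eq_zero_iff 3 p).1 (by exact_mod_cast h3)))
    (by omega)
  -- A third value would have to be both `c - d` and `c + 2 * d`, forcing `3 * d = 0`.
  have hall : ∀ e ∈ C, e = c ∨ e = c + d := by
    intro e he
    by_contra! hne
    rcases key c e hc he hne.1.symm with h1 | h1
    · exact hne.2 h1
    · rcases key (c + d) e hcd he hne.2.symm with h4 | h4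
      · exact mul_ne_zero h3 hd (by linear_combination -h1 - h4)
      · exact hd (by linear_combination h4 - h1)
  obtain ⟨C, rfl⟩ := exists_cons_of_mem hc
  obtain ⟨C, rfl⟩ := exists_cons_of_mem ((mem_cons.1 hcd).resolve_left (by simpa using hd))
  simp only [card_cons] at hC
  have hrep : replicate (card C) (c + d) ≤ C + C.map (· + d) := by
    have hall' : ∀ e ∈ C, e = c ∨ e = c + d := fun e he => hall e (by simp [he])
    clear h hc hcd hall hC key
    induction C using Multiset.induction with
    | empty => simp
    | cons e C ih =>
      have ih' := ih fun e he => hall' e (mem_cons_of_mem he)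
      rw [card_cons, replicate_succ, map_cons, cons_add, add_cons]
      rcases hall' e (mem_cons_self _ _) with rfl | rfl
      · exact (cons_le_cons _ ih').trans (le_cons_self _ _)
      · exact cons_le_cons _ (ih'.trans (le_cons_self _ _))
  -- Every remaining pair contains `c + d`. With `c`, `c + d`, `c + 2 * d` from the two named pairs,
  -- this makes `p` terms of mean `c + d`.
  refine h (c ::ₘ (c + d) ::ₘ (c + d + d) ::ₘ replicate (card C) (c + d)) ?_ (by simp; omega) ?_
  · have : (c ::ₘ (c + d) ::ₘ C) + (c ::ₘ (c + d) ::ₘ C).map (· + d) =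
        (c + d) ::ₘ c ::ₘ (c + d) ::ₘ (c + d + d) ::ₘ (C + C.map (· + d)) := by
      simp only [map_cons]
      simp only [← singleton_add]
      abel
    rw [this]
    exact (cons_le_cons _ (cons_le_cons _ (cons_le_cons _ hrep))).trans (le_cons_self _ _)
  · have hcast : (card C : ZMod p) + 3 = 0 := by
      rw [← ZMod.natCast_self p]
      exact_mod_cast congrArg (Nat.cast (R := ZMod p)) (by omega : card C + 3 = p)
    simp only [sum_cons, sum_replicate, nsmul_eq_mul]
    linear_combination (c + d) * hcast

end Prime

/-! ### The primes 2 and 3, and the prime case assembled -/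

open Multiset in
theorem exists_eq_replicate_of_two (A : Multiset (ZMod 2)) (hA : card A = 2) :
    ∃ a b, A = replicate 1 a + replicate 1 b := by
  obtain ⟨a, b, rfl⟩ := card_eq_two.1 hA
  exact ⟨a, b, rfl⟩

open Multiset in
theorem exists_eq_replicate_of_three (A : Multiset (ZMod 3)) (hA : card A = 4)
    (h : ZeroSumFree 3 A) : ∃ a b, A = replicate 2 a + replicate 2 b := by
  induction A using Quotient.inductionOn with | _ l
  obtain ⟨w, x, y, z, rfl⟩ : ∃ w x y z, l = [w, x, y, z] := by
    match l, hA with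
    | [w, x, y, z], _ => exact ⟨w, x, y, z, rfl⟩
  have hsub : ∀ s, List.Sublist s [w, x, y, z] → s.length = 3 → s.sum ≠ 0 := fun s hs hl =>
    h s (coe_le.2 hs.subperm) hl
  have h1 := hsub [w, x, y] (by simp) rfl
  have h2 := hsub [w, x, z] (by simp) rfl
  have h3 := hsub [w, y, z] (by simp) rfl
  have h4 := hsub [x, y, z] (by simp) rfl
  clear h hA hsub
  have key : ∀ w x y z : ZMod 3, [w, x, y].sum ≠ 0 → [w, x, z].sum ≠ 0 → [w, y, z].sum ≠ 0 →
      [x, y, z].sum ≠ 0 → ∃ a b, (([w, x, y, z] : List (ZMod 3)) : Multiset (ZMod 3)) =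
        replicate 2 a + replicate 2 b := by
    decide
  exact key w x y z h1 h2 h3 h4

/-- The conclusion of the inverse Erdős–Ginzburg–Ziv theorem for the modulus `n`. -/
def InverseEGZ (n : ℕ) : Prop :=
  ∀ A : Multiset (ZMod n), Multiset.card A = 2 * n - 2 → ZeroSumFree n A →
    ∃ a b, A = Multiset.replicate (n - 1) a + Multiset.replicate (n - 1) b

theorem inverseEGZ_prime {p : ℕ} (hp : p.Prime) : InverseEGZ p := by
  intro A hA h
  rcases lt_or_ge p 5 with h5 | h5
  · have h2 := hp.two_le
    interval_cases p
    · exact exists_eq_replicate_of_two A hA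
    · exact exists_eq_replicate_of_three A hA h
    · exact absurd hp (by decide)
  · have : Fact p.Prime := ⟨hp⟩
    exact exists_eq_replicate_of_five_le h5 A hA h

/-! ### Rigidity of extremal multisets, and blocks of integers -/

open Multiset

theorem InverseEGZ.count_eq {m : ℕ} (hm : 2 ≤ m) (hinv : InverseEGZ m) {A : Multiset (ZMod m)}
    (hA : card A = 2 * m - 2) (h : ZeroSumFree m A) (z : ZMod m) :
    A.count z = 0 ∨ A.count z = m - 1 := by
  obtain ⟨a, b, rfl⟩ := hinv A hA h
  have hab := h.ne hm
  rw [count_add, count_replicate, count_replicate]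
  split_ifs with h1 h2
  · exact absurd (h1.trans h2.symm) hab
  all_goals simp

theorem InverseEGZ.eq_of_cons {m : ℕ} (hm : 2 ≤ m) (hinv : InverseEGZ m) {E : Multiset (ZMod m)}
    (hE : card E = 2 * m - 3) {s s' : ZMod m} (h : ZeroSumFree m (s ::ₘ E))
    (h' : ZeroSumFree m (s' ::ₘ E)) : s = s' := by
  rcases hm.eq_or_lt with rfl | hm3
  · obtain ⟨e, rfl⟩ := card_eq_one.1 hE
    have h1 := h (s ::ₘ {e}) le_rfl rfl
    have h2 := h' (s' ::ₘ {e}) le_rfl rfl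
    simp only [sum_cons, sum_singleton] at h1 h2
    clear h h' hE
    revert s s' e
    decide
  -- The multiplicity of `s` in `E` and its successor would both lie in `{0, m - 1}`, impossible for
  -- `m ≥ 3`.
  · by_contra hne
    have h1 := hinv.count_eq hm (by simp [hE]; omega) h s
    have h2 := hinv.count_eq hm (by simp [hE]; omega) h' s
    rw [count_cons_self] at h1
    rw [count_cons_of_ne hne] at h2
    omega

/-- A multiset of `p` integers whose sum is divisible by `p`. -/
def IsBlock (p : ℕ) (B : Multiset ℤ) : Prop :=
  card B = p ∧ (p : ℤ) ∣ B.sum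

theorem isBlock_iff_map {p : ℕ} {B : Multiset ℤ} :
    IsBlock p B ↔ card (B.map (Int.cast : ℤ → ZMod p)) = p ∧
      (B.map (Int.cast : ℤ → ZMod p)).sum = 0 := by
  rw [IsBlock, card_map, ← ZMod.intCast_zmod_eq_zero_iff_dvd]
  have : (B.map (Int.cast : ℤ → ZMod p)).sum = ((B.sum : ℤ) : ZMod p) :=
    (map_multiset_sum (Int.castRingHom (ZMod p)) B).symm
  rw [this]

theorem exists_blocks {p : ℕ} (k : ℕ) : ∀ A : Multiset ℤ, k * p + p - 1 ≤ card A →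
    ∃ 𝓑 : Multiset (Multiset ℤ), card 𝓑 = k ∧ (∀ B ∈ 𝓑, IsBlock p B) ∧ 𝓑.join ≤ A := by
  induction k with
  | zero => exact fun A _ => ⟨0, rfl, by simp, by simp⟩
  | succ k ih =>
    intro A hA
    rw [Nat.succ_mul] at hA
    obtain ⟨B, hBA, hB⟩ := Int.erdos_ginzburg_ziv_multiset (n := p) A (by omega)
    obtain ⟨𝓑, h1, h2, h3⟩ := ih (A - B) (by rw [card_sub hBA, hB.1]; omega)
    refine ⟨B ::ₘ 𝓑, by simp [h1], ?_, ?_⟩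
    · intro C hC
      rcases mem_cons.1 hC with rfl | hC
      · exact hB
      · exact h2 C hC
    · rw [join_cons]
      calc B + 𝓑.join ≤ B + (A - B) := add_le_add_right h3 B
        _ = A := add_tsub_cancel_of_le hBA

theorem Multiset.exists_le_card_eq {α : Type*} {s : Multiset α} {n : ℕ} (h : n ≤ card s) :
    ∃ t ≤ s, card t = n := by
  induction s using Quotient.inductionOn with | _ l
  exact ⟨↑(l.take n), coe_le.2 (List.take_sublist n l).subperm, by simpa using h⟩

section Blocks

variable {p m : ℕ} {A : Multiset ℤ}

/-- Block sums are exact multiples of `p`, so `m` blocks whose quotients sum to zero mod `m` join to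
`p * m` terms with sum divisible by `p * m`. -/
theorem ZeroSumFree.quotient
    (h : ZeroSumFree (p * m) (A.map (Int.cast : ℤ → ZMod (p * m))))
    {𝓑 : Multiset (Multiset ℤ)} (h𝓑 : ∀ B ∈ 𝓑, IsBlock p B) (hA : 𝓑.join ≤ A) :
    ZeroSumFree m (𝓑.map fun B => ((B.sum / p : ℤ) : ZMod m)) := by
  intro S hS hcard hsum
  obtain ⟨𝓒, h𝓒, rfl⟩ := exists_le_map_eq _ _ S hS
  have hblock : ∀ B ∈ 𝓒, IsBlock p B := fun B hB => h𝓑 B (mem_of_le h𝓒 hB)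
  have hjoin : 𝓒.join ≤ A := by
    obtain ⟨𝓓, rfl⟩ := Multiset.le_iff_exists_add.1 h𝓒
    rw [join_add] at hA
    exact (Multiset.le_add_right _ _).trans hA
  rw [card_map] at hcard
  have hjc : ∀ 𝓒 : Multiset (Multiset ℤ), (∀ B ∈ 𝓒, IsBlock p B) →
      card 𝓒.join = p * card 𝓒 ∧
      ((𝓒.map fun B => ((B.sum / p : ℤ) : ZMod m)).sum = 0 → ((p * m : ℕ) : ℤ) ∣ 𝓒.join.sum) := by
    intro 𝓒 hb
    have : card 𝓒.join = p * card 𝓒 ∧ 𝓒.join.sum = p * (𝓒.map fun B => B.sum / (p : ℤ)).sum := by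
      induction 𝓒 using Multiset.induction with
      | empty => simp
      | cons B 𝓒 ih =>
        have ih := ih fun C hC => hb C (mem_cons_of_mem hC)
        have hB := hb B (mem_cons_self _ _)
        constructor
        · rw [join_cons, card_add, card_cons, ih.1, hB.1]; ring
        · rw [join_cons, sum_add, map_cons, sum_cons, ih.2, mul_add, Int.mul_ediv_cancel' hB.2]
    refine ⟨this.1, fun h0 => ?_⟩
    rw [this.2, Nat.cast_mul]
    refine mul_dvd_mul_left _ ?_
    rw [← ZMod.intCast_zmod_eq_zero_iff_dvd, ← h0]
    have := map_multiset_sum (Int.castRingHom (ZMod m)) (𝓒.map fun B => B.sum / (p : ℤ))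
    rw [Multiset.map_map] at this
    exact this
  obtain ⟨h1, h2⟩ := hjc 𝓒 hblock
  refine h (𝓒.join.map Int.cast) (map_le_map hjoin) (by rw [card_map, h1, hcard]) ?_
  have := map_multiset_sum (Int.castRingHom (ZMod (p * m))) 𝓒.join
  refine Eq.trans this.symm ?_
  exact (ZMod.intCast_zmod_eq_zero_iff_dvd _ _).2 (h2 hsum)

theorem ZeroSumFree.card_blocks_le (hm : 1 ≤ m)
    (h : ZeroSumFree (p * m) (A.map (Int.cast : ℤ → ZMod (p * m))))
    {𝓑 : Multiset (Multiset ℤ)} (h𝓑 : ∀ B ∈ 𝓑, IsBlock p B) (hA : 𝓑.join ≤ A) :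
    card 𝓑 ≤ 2 * m - 2 := by
  by_contra! hc
  obtain ⟨t, ht, htc, hts⟩ := ZMod.erdos_ginzburg_ziv_multiset (n := m)
    (𝓑.map fun B => ((B.sum / p : ℤ) : ZMod m)) (by rw [card_map]; omega)
  exact h.quotient h𝓑 hA t ht htc hts

/-- A zero sum in `R` would be one more block than `ZeroSumFree.card_blocks_le` allows. -/
theorem ZeroSumFree.remainder (hm : 1 ≤ m)
    (h : ZeroSumFree (p * m) (A.map (Int.cast : ℤ → ZMod (p * m))))
    {𝓑 : Multiset (Multiset ℤ)} {R : Multiset ℤ} (h𝓑 : ∀ B ∈ 𝓑, IsBlock p B)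
    (hcard : card 𝓑 = 2 * m - 2) (hA : 𝓑.join + R = A) :
    ZeroSumFree p (R.map (Int.cast : ℤ → ZMod p)) := by
  intro S hS hSc hSs
  obtain ⟨B, hB, rfl⟩ := exists_le_map_eq _ _ S hS
  have := h.card_blocks_le hm (𝓑 := B ::ₘ 𝓑) (by
    intro C hC
    rcases mem_cons.1 hC with rfl | hC
    · exact isBlock_iff_map.2 ⟨hSc, hSs⟩
    · exact h𝓑 C hC) (by
    rw [join_cons, ← hA, add_comm]
    exact add_le_add_right hB _)
  rw [card_cons] at this
  omega

end Blocks

/-- If removing any zero-sum `p`-term part of `B + R` leaves `p - 1` copies of each of two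
elements, then the elements of `B` are among those of `R`. -/
theorem eq_or_eq_of_remainders {p : ℕ} (hp : 2 ≤ p) {B : Multiset (ZMod p)} {a b : ZMod p}
    (hB : card B = p) (hBs : B.sum = 0) (hab : a ≠ b)
    (h : ∀ C ≤ B + (replicate (p - 1) a + replicate (p - 1) b), card C = p → C.sum = 0 →
      ∃ c d, c ≠ d ∧ B + (replicate (p - 1) a + replicate (p - 1) b) =
        C + (replicate (p - 1) c + replicate (p - 1) d)) :
    ∀ c ∈ B, c = a ∨ c = b := by
  intro c hc
  by_contra! hne
  obtain ⟨hca, hcb⟩ := hne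
  have hp0 : (((p - 1 : ℕ) : ℕ) : ZMod p) = -1 := by
    rw [Nat.cast_sub (by omega), ZMod.natCast_self]; simp
  -- If `D` omits a copy of `c`, so does the zero sum found in `D`; hence `c` is one of the two
  -- values left over.
  have key : ∀ D ≤ B + (replicate (p - 1) a + replicate (p - 1) b), 2 * p - 1 ≤ card D →
      (D.count c < (B + (replicate (p - 1) a + replicate (p - 1) b)).count c) →
      ∃ C ≤ D, card C = p ∧ C.sum = 0 ∧ ∃ e, e ≠ c ∧
        B + (replicate (p - 1) a + replicate (p - 1) b) =
        C + (replicate (p - 1) c + replicate (p - 1) e) := by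
    intro D hD hDc hcount
    obtain ⟨C, hCD, hC, hCs⟩ := ZMod.erdos_ginzburg_ziv_multiset (n := p) D hDc
    refine ⟨C, hCD, hC, hCs, ?_⟩
    obtain ⟨u, v, huv, he⟩ := h C (hCD.trans hD) hC hCs
    have hle := count_le_of_le c hCD
    rw [he, count_add] at hcount
    have : c ∈ replicate (p - 1) u + replicate (p - 1) v := count_pos.1 (by omega)
    rcases mem_add.1 this with h1 | h1
    · obtain rfl := eq_of_mem_replicate h1
      exact ⟨v, huv.symm, he⟩
    · obtain rfl := eq_of_mem_replicate h1
      exact ⟨u, huv, by rw [he, add_comm (replicate (p - 1) u)]⟩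
  obtain ⟨B1, rfl⟩ := exists_cons_of_mem hc
  rw [card_cons] at hB
  have hcount0 : count c (replicate (p - 1) a + replicate (p - 1) b) = 0 := by
    rw [count_add, count_replicate, count_replicate, if_neg (Ne.symm hca), if_neg (Ne.symm hcb)]
  obtain ⟨C, -, -, -, e, hec, he⟩ := key (B1 + (replicate (p - 1) a + replicate (p - 1) b))
    (by rw [cons_add]; exact le_cons_self _ _) (by simp; omega) (by simp)
  -- All copies of `c` lie in `B`, at least `p - 1` of them, and the zero sum determines the last
  -- term.
  have hBc : c ::ₘ B1 = replicate (p - 1) c + {c} := by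
    have h1 := congrArg (count c) he
    rw [count_add, hcount0, count_add, count_add, count_replicate_self] at h1
    obtain ⟨F, hF⟩ := Multiset.le_iff_exists_add.1
      (le_count_iff_replicate_le.1 (show p - 1 ≤ count c (c ::ₘ B1) by omega))
    have h2 := congrArg card hF
    rw [card_cons, card_add, card_replicate] at h2
    obtain ⟨f, rfl⟩ := card_eq_one.1 (show card F = 1 by omega)
    rw [hF] at hBs ⊢
    rw [sum_add, sum_replicate, sum_singleton, nsmul_eq_mul, hp0] at hBs
    rw [show f = c by linear_combination hBs]
  rw [hBc] at key
  clear he hec e C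
  have hc1 : 1 ≤ p - 1 := by omega
  -- Now `B` is `p` copies of `c`. The zero sum found here must be one `c` and `p - 1` copies of `a`
  -- or of `b`, which forces `c` to equal that element.
  obtain ⟨C, -, -, hCs, e, hec, he⟩ := key (c ::ₘ (replicate (p - 1) a + replicate (p - 1) b))
    (by rw [← singleton_add]; exact add_le_add_left (by simp) _) (by simp; omega)
    (by
      rw [count_cons_self, hcount0, count_add, hcount0, count_add, count_replicate_self,
        count_singleton_self]
      omega)
  have heT : e ∈ replicate (p - 1) c + {c} + (replicate (p - 1) a + replicate (p - 1) b) := by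
    rw [he]
    exact mem_add.2 (Or.inr (mem_add.2 (Or.inr (mem_replicate.2 ⟨by omega, rfl⟩))))
  have hfin : ∀ x, C = {c} + replicate (p - 1) x → c = x := by
    rintro x rfl
    rw [sum_add, sum_replicate, sum_singleton, nsmul_eq_mul, hp0] at hCs
    linear_combination hCs
  simp only [mem_add, mem_replicate, mem_singleton] at heT
  rcases heT with (⟨-, h1⟩ | h1) | ⟨-, rfl⟩ | ⟨-, rfl⟩
  · exact hec h1
  · exact hec h1
  · refine hcb (hfin b (add_right_cancel (b := replicate (p - 1) c + replicate (p - 1) e) ?_))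
    rw [← he]; abel
  · refine hca (hfin a (add_right_cancel (b := replicate (p - 1) c + replicate (p - 1) e) ?_))
    rw [← he]; abel

/-! ### Residues mod `p` and equality mod `p * m` -/

section Composite

variable {p m : ℕ} {A : Multiset ℤ}

theorem ZeroSumFree.exists_two_residues (hp : 2 ≤ p) (hm : 2 ≤ m) (hinv : InverseEGZ p)
    (hA : card A = 2 * (p * m) - 2)
    (h : ZeroSumFree (p * m) (A.map (Int.cast : ℤ → ZMod (p * m)))) :
    ∃ a b : ZMod p, ∀ x ∈ A, (x : ZMod p) = a ∨ (x : ZMod p) = b := by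
  obtain ⟨k, rfl⟩ : ∃ k, m = k + 2 := ⟨m - 2, by omega⟩
  obtain ⟨𝓑, h𝓑c, h𝓑, h𝓑A⟩ := exists_blocks (p := p) (2 * (k + 2) - 2) A (by
    rw [hA, show 2 * (k + 2) - 2 = 2 * k + 2 by omega]; ring_nf; omega)
  obtain ⟨R, rfl⟩ := Multiset.le_iff_exists_add.1 h𝓑A
  have hjoin : ∀ 𝓒 : Multiset (Multiset ℤ), (∀ B ∈ 𝓒, IsBlock p B) →
      card 𝓒.join = card 𝓒 * p := by
    intro 𝓒 h𝓒
    rw [card_join, map_congr rfl fun B hB => (h𝓒 B hB).1, map_const', sum_replicate, smul_eq_mul]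
  have hRc : card R = 2 * p - 2 := by
    rw [card_add, hjoin 𝓑 h𝓑, h𝓑c, show 2 * (k + 2) - 2 = 2 * k + 2 by omega] at hA
    ring_nf at hA ⊢
    omega
  have hRz := h.remainder (by omega) h𝓑 h𝓑c rfl
  obtain ⟨a, b, hab⟩ := hinv _ (by rw [card_map, hRc]) hRz
  refine ⟨a, b, fun x hx => ?_⟩
  rcases mem_add.1 hx with hx | hx
  · obtain ⟨B, hB, hxB⟩ := mem_join.1 hx
    obtain ⟨𝓒, rfl⟩ := exists_cons_of_mem hB
    obtain ⟨hBc, hBs⟩ := isBlock_iff_map.1 (h𝓑 B hB)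
    refine eq_or_eq_of_remainders hp (B := B.map (Int.cast : ℤ → ZMod p)) hBc hBs
      ((hab ▸ hRz).ne hp) ?_ _ (mem_map_of_mem _ hxB)
    -- The block `B` may be exchanged for any other block inside `B + R`, and the new remainder is
    -- again extremal.
    rw [← hab, ← Multiset.map_add]
    intro C hC hCc hCs
    obtain ⟨D, hD, rfl⟩ := exists_le_map_eq _ _ C hC
    obtain ⟨R', hR'⟩ := Multiset.le_iff_exists_add.1 hD
    have hR'z := h.remainder (𝓑 := D ::ₘ 𝓒) (R := R') (by omega) (by
      intro E hE
      rcases mem_cons.1 hE with rfl | hE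
      · exact isBlock_iff_map.2 ⟨hCc, hCs⟩
      · exact h𝓑 E (mem_cons_of_mem hE)) (by simpa using h𝓑c) (by
      rw [join_cons, join_cons, add_right_comm, ← hR']; abel)
    have hR'c := congrArg card hR'
    rw [card_add, card_add, hRc] at hR'c
    rw [card_map] at hCc hBc
    obtain ⟨c, d, hcd⟩ := hinv _ (by rw [card_map]; omega) hR'z
    exact ⟨c, d, (hcd ▸ hR'z).ne hp, by rw [hR', Multiset.map_add, hcd]⟩
  · have := mem_map_of_mem (Int.cast : ℤ → ZMod p) hx
    rw [hab] at this
    exact (mem_add.1 this).imp eq_of_mem_replicate eq_of_mem_replicate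

/-- Both `x ::ₘ D` and `y ::ₘ D` are blocks, and each completes the same `2 * m - 3` blocks. By
`InverseEGZ.eq_of_cons` their quotients agree mod `m`, so `p * m` divides `y - x`. -/
theorem ZeroSumFree.intCast_eq_of_swap (hp : 2 ≤ p) (hm : 2 ≤ m) (hinv : InverseEGZ m)
    (hA : card A = 2 * (p * m) - 2)
    (h : ZeroSumFree (p * m) (A.map (Int.cast : ℤ → ZMod (p * m)))) {x y : ℤ} {D : Multiset ℤ}
    (hD : card D = p - 1) (hDA : x ::ₘ y ::ₘ D ≤ A) (hxy : (x : ZMod p) = y)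
    (hDx : ∀ z ∈ D, (z : ZMod p) = x) : (x : ZMod (p * m)) = y := by
  obtain ⟨k, rfl⟩ : ∃ k, m = k + 2 := ⟨m - 2, by omega⟩
  obtain ⟨A', rfl⟩ := Multiset.le_iff_exists_add.1 hDA
  have hblock : ∀ w : ℤ, (w : ZMod p) = x → IsBlock p (w ::ₘ D) := by
    intro w hw
    refine isBlock_iff_map.2 ⟨by simp [hD]; omega, ?_⟩
    have : (w ::ₘ D).map (Int.cast : ℤ → ZMod p) = replicate p (x : ZMod p) := by
      rw [eq_replicate]
      refine ⟨by simp [hD]; omega, fun b hb => ?_⟩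
      obtain ⟨z, hz, rfl⟩ := mem_map.1 hb
      rcases mem_cons.1 hz with rfl | hz
      · exact hw
      · exact hDx z hz
    rw [this, sum_replicate, nsmul_eq_mul, ZMod.natCast_self, zero_mul]
  obtain ⟨𝓑, h𝓑c, h𝓑, h𝓑A⟩ := exists_blocks (p := p) (2 * (k + 2) - 3) A' (by
    simp only [card_add, card_cons, hD] at hA
    rw [show 2 * (k + 2) - 3 = 2 * k + 1 by omega]
    ring_nf at hA ⊢
    omega)
  have hz : ∀ w : ℤ, (w : ZMod p) = x → w ::ₘ D ≤ x ::ₘ y ::ₘ D →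
      ZeroSumFree (k + 2) ((((w ::ₘ D).sum / p : ℤ) : ZMod (k + 2)) ::ₘ
        𝓑.map fun B => ((B.sum / p : ℤ) : ZMod (k + 2))) := by
    intro w hw hle
    have := h.quotient (𝓑 := (w ::ₘ D) ::ₘ 𝓑) (by
      intro C hC
      rcases mem_cons.1 hC with rfl | hC
      · exact hblock w hw
      · exact h𝓑 C hC) (by rw [join_cons]; exact add_le_add hle h𝓑A)
    rwa [map_cons] at this
  have heq := hinv.eq_of_cons (by omega) (by rw [card_map, h𝓑c])
    (hz x rfl (cons_le_cons _ (le_cons_self _ _))) (hz y hxy.symm (le_cons_self _ _))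
  obtain ⟨s, hs⟩ := (hblock x rfl).2
  obtain ⟨t, ht⟩ := (hblock y hxy.symm).2
  have hp0 : (p : ℤ) ≠ 0 := by positivity
  rw [hs, ht, Int.mul_ediv_cancel_left _ hp0, Int.mul_ediv_cancel_left _ hp0,
    ZMod.intCast_eq_intCast_iff_dvd_sub] at heq
  rw [ZMod.intCast_eq_intCast_iff_dvd_sub, Nat.cast_mul]
  have : y - x = p * (t - s) := by
    rw [sum_cons] at hs ht
    linear_combination ht - hs
  rw [this]
  exact mul_dvd_mul_left _ heq

theorem ZeroSumFree.exists_eq_replicate_of_residue (hp : 2 ≤ p) (hm : 2 ≤ m)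
    (hinv : InverseEGZ m) (hA : card A = 2 * (p * m) - 2)
    (h : ZeroSumFree (p * m) (A.map (Int.cast : ℤ → ZMod (p * m)))) {a : ZMod p}
    {A' : Multiset ℤ} (hA' : A' ≤ A) (ha : ∀ x ∈ A', (x : ZMod p) = a)
    (hcard : p + 1 ≤ card A') :
    card A' ≤ p * m - 1 ∧
      ∃ c, A'.map (Int.cast : ℤ → ZMod (p * m)) = replicate (card A') c := by
  obtain ⟨x, hx⟩ := card_pos_iff_exists_mem.1 (show 0 < card A' by omega)
  have hrep : A'.map (Int.cast : ℤ → ZMod (p * m)) = replicate (card A') (x : ZMod (p * m)) := by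
    rw [eq_replicate]
    refine ⟨card_map _ _, fun b hb => ?_⟩
    obtain ⟨y, hy, rfl⟩ := mem_map.1 hb
    by_cases hyx : y = x
    · rw [hyx]
    obtain ⟨D, rfl⟩ := exists_cons_of_mem hx
    obtain ⟨D, rfl⟩ := exists_cons_of_mem ((mem_cons.1 hy).resolve_left hyx)
    simp only [card_cons] at hcard
    obtain ⟨E, hE, hEc⟩ := exists_le_card_eq (s := D) (n := p - 1) (by omega)
    refine (h.intCast_eq_of_swap hp hm hinv hA hEc
      ((cons_le_cons _ (cons_le_cons _ hE)).trans hA') ?_ ?_).symm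
    · rw [ha x (by simp), ha y (by simp)]
    · intro z hz
      rw [ha x (by simp), ha z (by simp [mem_of_le hE hz])]
  refine ⟨?_, x, hrep⟩
  have := (h.mono (map_le_map hA')).count_lt (x : ZMod (p * m))
  rw [hrep, count_replicate_self] at this
  omega

end Composite

/-! ### Products and induction on prime factors -/

theorem InverseEGZ.mul {p m : ℕ} (hp : 2 ≤ p) (hm : 2 ≤ m) (hinvp : InverseEGZ p)
    (hinvm : InverseEGZ m) : InverseEGZ (p * m) := by
  intro A hA h
  obtain ⟨A, rfl⟩ : ∃ A' : Multiset ℤ, A'.map (Int.cast : ℤ → ZMod (p * m)) = A :=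
    map_surjective_of_surjective ZMod.intCast_surjective A
  rw [card_map] at hA
  obtain ⟨a, b, hab⟩ := h.exists_two_residues hp hm hinvp hA
  have hsplit := filter_add_not (fun x : ℤ => (x : ZMod p) = a) A
  set A0 := A.filter (fun x : ℤ => (x : ZMod p) = a) with hA0
  set A1 := A.filter (fun x : ℤ => ¬ (x : ZMod p) = a) with hA1
  have hle0 : A0 ≤ A := filter_le _ _
  have hle1 : A1 ≤ A := filter_le _ _
  have ha : ∀ x ∈ A0, (x : ZMod p) = a := fun x hx => (mem_filter.1 hx).2
  have hb : ∀ x ∈ A1, (x : ZMod p) = b := fun x hx =>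
    (hab x (mem_filter.1 hx).1).resolve_left (mem_filter.1 hx).2
  have hcard := congrArg card hsplit
  rw [card_add, hA] at hcard
  have hpm : p + 2 ≤ p * m := by nlinarith
  have h0 := h.exists_eq_replicate_of_residue hp hm hinvm hA hle0 ha
  have h1 := h.exists_eq_replicate_of_residue hp hm hinvm hA hle1 hb
  -- A class of at most `p` terms would leave the other at least `p * m`, above the bound `p * m -
  -- 1`.
  have h0' : p + 1 ≤ card A0 := by
    by_contra! hlt
    have := (h1 (by omega)).1
    omega
  have h1' : p + 1 ≤ card A1 := by
    by_contra! hlt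
    have := (h0 (by omega)).1
    omega
  obtain ⟨hc0, c, hc⟩ := h0 h0'
  obtain ⟨hd0, d, hd⟩ := h1 h1'
  refine ⟨c, d, ?_⟩
  rw [← hsplit, Multiset.map_add, hc, hd, show card A0 = p * m - 1 by omega,
    show card A1 = p * m - 1 by omega]

theorem inverseEGZ (n : ℕ) (hn : 1 ≤ n) : InverseEGZ n := by
  induction n using induction_on_primes with
  | zero => omega
  | one =>
    intro A hA _
    exact ⟨0, 0, by simpa using hA⟩
  | prime_mul p m hp ih =>
    rcases (show m = 0 ∨ m = 1 ∨ 2 ≤ m by omega) with rfl | rfl | hm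
    · simp at hn
    · rw [mul_one]
      exact inverseEGZ_prime hp
    · exact (inverseEGZ_prime hp).mul hp.two_le hm (ih (by omega))

theorem mainTheorem5 (n : ℕ) (hn : 1 ≤ n) (A : Multiset (ZMod n))
    (hcard : Multiset.card A = 2 * n - 2)
    (hA : ¬ ∃ B : Multiset (ZMod n), B ≤ A ∧ Multiset.card B = n ∧ B.sum = 0) :
    ∃ a b : ZMod n, Nat.gcd (b - a).val n = 1 ∧
      A = Multiset.replicate (n - 1) a + Multiset.replicate (n - 1) b := by
  have h : ZeroSumFree n A := fun B hB hBc hBs => hA ⟨B, hB, hBc, hBs⟩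
  obtain ⟨a, b, rfl⟩ := inverseEGZ n hn A hcard h
  exact ⟨a, b, h.gcd_eq_one hn, rfl⟩
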